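/- Let $X_1,X_2,\dots$ be i.i.d. real random variables with mean $\mu={\sf E}[X_1]>0$, standard deviation $\sigma={\sf sd}[X_1]$ and ${\sf E}[|X_1|^3]<\infty$. Put $S_k=X_1+\dots+X_k$, $Z_k=X_1^2+\dots+X_k^2$, $S_0=Z_0=0$. For $\Delta,\Gamma>0$ let $\tau_0=\theta_0=0$ and, for $n\ge 1$, $$\tau_n=\inf\{k\ge\tau_{n-1}:\ S_k-S_{\tau_{n-1}}\ge\Delta\},\qquad \theta_n=\inf\{k\ge\theta_{n-1}:\ Z_k-Z_{\theta_{n-1}}\ge\Gamma\},$$ where $k$ ranges over the nonnegative integers and $\inf\emptyset=\infty$. For $t>0$ let $N(t)=\max\{n:\tau_n\le t\}$, $\tau(t)=\tau_{N(t)}$, $M(t)=\max\{n:\theta_n\le t\}$, $\theta(t)=\theta_{M(t)}$, and $$\hat\mu_t=\frac{\Delta N(t)}{\tau(t)},\qquad \hat\sigma_t=\sqrt{\frac{\Gamma M(t)}{\theta(t)}-\hat\mu_t^{\,2}},$$ which are considered on the event $\{t\ge\tau_1,\ t\ge\theta_1\}$. (Off this event a quotient $0/0$ is read as $0$, and the square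 root of a negative number is read as $0$.) Then, as $\Delta,\Gamma,t\to\infty$ so that $\Delta=o(t)$ and $\Gamma=o(t)$, we have ${\sf P}(t\ge\tau_1,\ t\ge\theta_1)\to 1$ and $\hat\sigma_t\to\sigma$ in probability; that is, $\hat\sigma_t$ is a consistent estimator of $\sigma$. -/

import Mathlib

namespace HittingSampling

noncomputable section

/-- The partial sums `s 0 = 0`, `s n = x 0 + ... + x (n - 1)` of a real sequence; here `x i` is the
observation made at time `i + 1`. -/
def partialSum (x : ℕ → ℝ) (n : ℕ) : ℝ := ∑ i ∈ Finset.range n, x i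

/-- The successive times at which the path `s` has grown by at least `c` since the previous such
time: `τ 0 = 0` and `τ (n + 1) = inf {k ≥ τ n : s k - s (τ n) ≥ c}`, where `inf ∅ = ∞`
(and `τ (n + 1) = ∞` when `τ n = ∞`, since then no natural number `k` satisfies `τ n ≤ k`). -/
def crossingTime (s : ℕ → ℝ) (c : ℝ) : ℕ → ℕ∞
  | 0 => 0
  | n + 1 => ⨅ k ∈ {k : ℕ | crossingTime s c n ≤ (k : ℕ∞) ∧
      c ≤ s k - s (crossingTime s c n).toNat}, (k : ℕ∞)

/-- The number of crossings up to time `t`: `max {n : τ n ≤ t}`. For `c > 0` and `t ≥ 0` the set is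
nonempty and finite, so that the supremum is a maximum. -/
def crossingCount (s : ℕ → ℝ) (c t : ℝ) : ℕ :=
  sSup {n : ℕ | ∃ k : ℕ, crossingTime s c n = (k : ℕ∞) ∧ (k : ℝ) ≤ t}

/-- The last crossing time not exceeding `t`. -/
def lastCrossing (s : ℕ → ℝ) (c t : ℝ) : ℕ :=
  (crossingTime s c (crossingCount s c t)).toNat

/-- The threshold times the number of crossings up to time `t`, divided by the last crossing time;
meaningful once there has been a crossing. -/
def crossingRate (s : ℕ → ℝ) (c t : ℝ) : ℝ :=
  c * (crossingCount s c t : ℝ) / (lastCrossing s c t : ℝ)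

/-- The estimator `Δ N(t) / τ(t)` of the mean, computed from the sample path `x`. -/
def muHat (x : ℕ → ℝ) (Δ t : ℝ) : ℝ := crossingRate (partialSum x) Δ t

/-- The estimator `√(Γ M(t) / θ(t) - (Δ N(t) / τ(t)) ^ 2)` of the standard deviation, computed from
the sample path `x`; `M` and `θ` come from the crossings of level `Γ` by the sums of squares.
The square root of a negative number is read as `0`. -/
def sigmaHat (x : ℕ → ℝ) (Δ Γ t : ℝ) : ℝ :=
  √(crossingRate (partialSum fun i => x i ^ 2) Γ t - muHat x Δ t ^ 2)

end

end HittingSampling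

open Filter Topology MeasureTheory ProbabilityTheory

namespace HittingSampling

/-! The argument is pathwise. With `k` the last crossing time and `N` the count, `c * N ≤ s k`, and
the gap is the total overshoot, each overshoot being less than the increment that crosses. Cutting
increments at `A` bounds the gap by `A * N` plus the sum of the excesses over `A`. Divided by `k`,
the first term vanishes since `N / k = O(1 / c)`, and the second is small for large `A` by the
strong law. As `k → ∞`, the rate has the limit of `s k / k` (`tendsto_crossingRate`). Applied to `X`
and `X ^ 2`, this gives the mean and the second moment almost surely, hence the standard deviation.
-/

/-! ### Crossings of a deterministic path. -/

theorem crossingTime_succ_eq_iff (s : ℕ → ℝ) (c : ℝ) (n k : ℕ) :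
    crossingTime s c (n + 1) = k ↔
      ∃ j ≤ k, crossingTime s c n = j ∧ c ≤ s k - s j ∧
        ∀ i < k, j ≤ i → s i - s j < c := by
  have hdef : crossingTime s c (n + 1) =
      ⨅ k ∈ {k : ℕ | crossingTime s c n ≤ (k : ℕ∞) ∧
        c ≤ s k - s (crossingTime s c n).toNat}, (k : ℕ∞) := rfl
  set S := {k : ℕ | crossingTime s c n ≤ (k : ℕ∞) ∧ c ≤ s k - s (crossingTime s c n).toNat} with hS
  constructor
  · intro h
    have hne : S.Nonempty := by
      by_contra hne
      rw [Set.not_nonempty_iff_eq_empty] at hne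
      rw [hdef, hne] at h
      simp at h
    have hk : k = sInf S := by
      have : crossingTime s c (n + 1) = ((sInf S : ℕ) : ℕ∞) := by
        rw [hdef]
        apply le_antisymm
        · exact iInf₂_le _ (Nat.sInf_mem hne)
        · exact le_iInf₂ fun i hi => by exact_mod_cast Nat.sInf_le hi
      rw [this] at h
      exact_mod_cast h.symm
    have hmem : k ∈ S := hk ▸ Nat.sInf_mem hne
    have hfin : crossingTime s c n ≠ ⊤ := fun h => by
      rw [hS] at hmem
      simp [h] at hmem
    obtain ⟨j, hj⟩ := ENat.ne_top_iff_exists.1 hfin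
    rw [hS] at hmem
    simp only [← hj, Set.mem_ofPred_eq, ENat.toNat_natCast, Nat.cast_le] at hmem
    refine ⟨j, hmem.1, hj.symm, hmem.2, fun i hik hji => ?_⟩
    by_contra! hi
    have : i ∈ S := by
      rw [hS]
      simp only [← hj, Set.mem_ofPred_eq, ENat.toNat_natCast, Nat.cast_le]
      exact ⟨hji, hi⟩
    have := Nat.sInf_le this
    omega
  · rintro ⟨j, hjk, hj, hc, hlt⟩
    rw [hdef]
    apply le_antisymm
    · refine iInf₂_le k ?_
      rw [hS]
      simp only [hj, Set.mem_ofPred_eq, ENat.toNat_natCast, Nat.cast_le]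
      exact ⟨hjk, hc⟩
    · refine le_iInf₂ fun i hi => ?_
      rw [hS] at hi
      simp only [hj, Set.mem_ofPred_eq, ENat.toNat_natCast, Nat.cast_le] at hi
      by_contra! h
      have := hlt i (by exact_mod_cast h) hi.1
      linarith [hi.2]

theorem exists_crossingTime_succ_le {s : ℕ → ℝ} {c : ℝ} {n j k : ℕ}
    (hj : crossingTime s c n = j) (hjk : j ≤ k) (hc : c ≤ s k - s j) :
    ∃ i ≤ k, crossingTime s c (n + 1) = i := by
  classical
  have hex : ∃ i, j ≤ i ∧ c ≤ s i - s j := ⟨k, hjk, hc⟩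
  refine ⟨Nat.find hex, Nat.find_min' hex ⟨hjk, hc⟩, ?_⟩
  rw [crossingTime_succ_eq_iff]
  refine ⟨j, (Nat.find_spec hex).1, hj, (Nat.find_spec hex).2, fun i hi hji => ?_⟩
  by_contra! h
  exact Nat.find_min hex hi ⟨hji, h⟩

theorem le_of_crossingTime_eq {s : ℕ → ℝ} {c : ℝ} (hc : 0 < c) {n k : ℕ}
    (h : crossingTime s c n = k) : n ≤ k := by
  induction n generalizing k with
  | zero => exact Nat.zero_le _
  | succ n ih =>
    obtain ⟨j, hjk, hj, hcj, -⟩ := (crossingTime_succ_eq_iff s c n k).1 h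
    have hne : j ≠ k := by
      rintro rfl
      linarith
    have := ih hj
    omega

theorem mul_le_of_crossingTime_eq {s : ℕ → ℝ} (hs : s 0 = 0) {c : ℝ} {n k : ℕ}
    (h : crossingTime s c n = k) : c * n ≤ s k := by
  induction n generalizing k with
  | zero =>
    have : k = 0 := Nat.cast_eq_zero.1 (h.symm : (k : ℕ∞) = 0)
    simp [this, hs]
  | succ n ih =>
    obtain ⟨j, hjk, hj, hcj, -⟩ := (crossingTime_succ_eq_iff s c n k).1 h
    have := ih hj
    push_cast
    linarith

/-- Just before a crossing the growth is below `c`, so the crossing increment `x m` adds at most `A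
+ max (x m - A) 0`. Crossing times strictly increase, so each excess is charged at most once. -/
theorem partialSum_le_of_crossingTime_eq {x : ℕ → ℝ} {c A : ℝ} (hc : 0 < c) {n k : ℕ}
    (h : crossingTime (partialSum x) c n = k) :
    partialSum x k ≤ (c + A) * n + partialSum (fun i => max (x i - A) 0) k := by
  induction n generalizing k with
  | zero =>
    have : k = 0 := Nat.cast_eq_zero.1 (h.symm : (k : ℕ∞) = 0)
    simp [this, partialSum]
  | succ n ih =>
    obtain ⟨j, hjk, hj, hcj, hlt⟩ := (crossingTime_succ_eq_iff _ c n k).1 h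
    have hne : j ≠ k := by
      rintro rfl
      linarith
    obtain ⟨m, rfl⟩ : ∃ m, k = m + 1 := ⟨k - 1, by omega⟩
    have h1 := hlt m (by omega) (by omega)
    have h2 := ih hj
    have h3 : partialSum (fun i => max (x i - A) 0) j ≤ partialSum (fun i => max (x i - A) 0) m :=
      Finset.sum_le_sum_of_subset_of_nonneg (Finset.range_mono (by omega))
        fun _ _ _ => le_max_right _ _
    have h4 : partialSum x (m + 1) = partialSum x m + x m := Finset.sum_range_succ _ _
    have h5 : partialSum (fun i => max (x i - A) 0) (m + 1) =
      partialSum (fun i => max (x i - A) 0) m + max (x m - A) 0 := Finset.sum_range_succ _ _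
    have h6 := le_max_left (x m - A) 0
    push_cast
    linarith

theorem crossingTime_crossingCount (s : ℕ → ℝ) {c t : ℝ} (hc : 0 < c) (ht : 0 ≤ t) :
    crossingTime s c (crossingCount s c t) = lastCrossing s c t ∧
      (lastCrossing s c t : ℝ) ≤ t ∧
      ∀ k : ℕ, lastCrossing s c t ≤ k → (k : ℝ) ≤ t → s k - s (lastCrossing s c t) < c := by
  set S := {n : ℕ | ∃ k : ℕ, crossingTime s c n = (k : ℕ∞) ∧ (k : ℝ) ≤ t} with hS
  have hbdd : BddAbove S := by
    refine ⟨⌊t⌋₊, ?_⟩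
    rintro n ⟨k, hk, hkt⟩
    exact (le_of_crossingTime_eq hc hk).trans (Nat.le_floor hkt)
  have hne : S.Nonempty := ⟨0, 0, rfl, by simpa using ht⟩
  obtain ⟨k, hk, hkt⟩ : crossingCount s c t ∈ S := Nat.sSup_mem hne hbdd
  have hlast : lastCrossing s c t = k := by simp [lastCrossing, hk]
  refine ⟨by rw [hk, hlast], by rwa [hlast], fun i hi hit => ?_⟩
  by_contra! h
  rw [hlast] at hi h
  -- Growth by `c` before `t` would produce one more crossing, against maximality.
  obtain ⟨m, hmi, hm⟩ := exists_crossingTime_succ_le hk hi h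
  have : crossingCount s c t + 1 ∈ S :=
    ⟨m, hm, (Nat.cast_le.2 hmi).trans hit⟩
  have : crossingCount s c t + 1 ≤ crossingCount s c t := le_csSup hbdd this
  omega

/-- If `s n / n → m > 0` and the means of the increments in excess of a large `A` are eventually
small, then the crossing rate converges to `m`. -/
theorem tendsto_crossingRate {ι : Type*} {l : Filter ι} {c t : ι → ℝ} {x : ℕ → ℝ} {m : ℝ}
    (hm : 0 < m) (hx : Tendsto (fun n : ℕ => partialSum x n / n) atTop (𝓝 m))
    (htrunc : ∀ ε > 0, ∃ A : ℝ, ∀ᶠ n : ℕ in atTop,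
      partialSum (fun i => max (x i - A) 0) n / n < ε)
    (hc : Tendsto c l atTop) (ht : Tendsto t l atTop)
    (hct : Tendsto (fun j => c j / t j) l (𝓝 0)) :
    Tendsto (fun j => crossingRate (partialSum x) (c j) (t j)) l (𝓝 m) := by
  have hc0 := hc.eventually_gt_atTop 0
  have ht0 := ht.eventually_gt_atTop 0
  have hlast : Tendsto (fun j => lastCrossing (partialSum x) (c j) (t j)) l atTop := by
    refine tendsto_atTop.2 fun M => ?_
    -- `B` bounds the path before time `M`. A last crossing before `M` would force `s ⌊t⌋ < B + c =
    -- o(t)`, while `s ⌊t⌋ / t → m > 0`.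
    set B := ∑ i ∈ Finset.range M, |x i|
    have hfl : Tendsto (fun j => ⌊t j⌋₊) l atTop := tendsto_nat_floor_atTop.comp ht
    have h1 : Tendsto (fun j => partialSum x ⌊t j⌋₊ / t j) l (𝓝 m) := by
      have := (hx.comp hfl).mul ((tendsto_nat_floor_div_atTop (R := ℝ)).comp ht)
      rw [mul_one] at this
      refine this.congr' ?_
      filter_upwards [hfl.eventually_gt_atTop 0] with j hj
      have : (⌊t j⌋₊ : ℝ) ≠ 0 := by exact_mod_cast hj.ne'
      simp only [Function.comp]
      field_simp
    have h2 : Tendsto (fun j => B / t j + c j / t j) l (𝓝 0) := by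
      simpa using (tendsto_const_nhds.div_atTop ht).add hct
    filter_upwards [hc0, ht0, h2.eventually_lt h1 hm, hfl.eventually_ge_atTop M] with j hcj htj h12 hM
    by_contra! hlt
    obtain ⟨-, -, h3⟩ := crossingTime_crossingCount (partialSum x) hcj htj.le
    have h4 := h3 ⌊t j⌋₊ (by omega) (Nat.floor_le htj.le)
    have h5 : partialSum x (lastCrossing (partialSum x) (c j) (t j)) ≤ B :=
      (Finset.sum_le_sum fun i _ => le_abs_self (x i)).trans
        (Finset.sum_le_sum_of_subset_of_nonneg (Finset.range_mono hlt.le) fun _ _ _ => abs_nonneg _)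
    rw [← add_div, div_lt_div_iff_of_pos_right htj] at h12
    linarith
  have hxl := hx.comp hlast
  have hle : ∀ᶠ j in l, crossingRate (partialSum x) (c j) (t j) ≤
      partialSum x (lastCrossing (partialSum x) (c j) (t j)) /
        (lastCrossing (partialSum x) (c j) (t j) : ℕ) := by
    filter_upwards [hc0, ht0] with j hcj htj
    have h1 := (crossingTime_crossingCount (partialSum x) hcj htj.le).1
    exact div_le_div_of_nonneg_right (mul_le_of_crossingTime_eq (by simp [partialSum]) h1)
      (Nat.cast_nonneg _)
  refine tendsto_order.2 ⟨fun a ha => ?_, fun a ha => ?_⟩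
  -- Three errors share `m - a`: the mean excess over `A`, the term `A * N / k`, and the distance of
  -- `s k / k` below `m`.
  · obtain ⟨A, hA⟩ := htrunc ((m - a) / 3) (by linarith)
    have h1 : Tendsto (fun j => |A| * ((m + 1) / c j)) l (𝓝 0) := by
      simpa using (tendsto_const_nhds.div_atTop hc).const_mul |A|
    filter_upwards [hle, hc0, ht0, hlast.eventually hA, hlast.eventually_gt_atTop 0,
      hxl.eventually_lt_const (show m < m + 1 by linarith),
      hxl.eventually_const_lt (show m - (m - a) / 3 < m by linarith),
      h1.eventually_lt_const (show 0 < (m - a) / 3 by linarith)]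
      with j hlej hcj htj hAj hpos hup hlow hsm
    have h2 := partialSum_le_of_crossingTime_eq (A := A) hcj
      (crossingTime_crossingCount (partialSum x) hcj htj.le).1
    simp only [Function.comp] at hup hlow
    unfold crossingRate at hlej ⊢
    set k := lastCrossing (partialSum x) (c j) (t j)
    set N : ℝ := (crossingCount (partialSum x) (c j) (t j) : ℝ)
    have hk : (0 : ℝ) < k := by exact_mod_cast hpos
    have h3 : N / k ≤ (m + 1) / c j := by
      rw [le_div_iff₀ hcj]
      calc N / k * c j = c j * N / k := by ring
        _ ≤ m + 1 := hlej.trans hup.le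
    have h4 : A * (N / k) ≤ |A| * ((m + 1) / c j) :=
      mul_le_mul (le_abs_self A) h3 (by positivity) (abs_nonneg A)
    have h5 : partialSum x k / k ≤ c j * N / k + A * (N / k) +
        partialSum (fun i => max (x i - A) 0) k / k := by
      rw [div_le_iff₀ hk]
      calc _ ≤ _ := h2
        _ = _ := by field_simp
    linarith
  · filter_upwards [hle, hxl.eventually_lt_const ha] with j h1 h2
    exact h1.trans_lt h2

theorem eventually_one_le_crossingCount {ι : Type*} {l : Filter ι} {c t : ι → ℝ} {s : ℕ → ℝ}
    {m : ℝ} (hm : 0 < m) (h : Tendsto (fun j => crossingRate s (c j) (t j)) l (𝓝 m)) :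
    ∀ᶠ j in l, 1 ≤ crossingCount s (c j) (t j) := by
  filter_upwards [h.eventually_const_lt hm] with j hj
  by_contra! h0
  have : crossingCount s (c j) (t j) = 0 := by omega
  simp [crossingRate, this] at hj

/-! ### Measurability of the crossing statistics. -/

theorem measurableSet_crossingTime_eq {Ω : Type*} [MeasurableSpace Ω] {s : ℕ → Ω → ℝ}
    (hs : ∀ i, Measurable (s i)) (c : ℝ) (n k : ℕ) :
    MeasurableSet {ω | crossingTime (fun i => s i ω) c n = k} := by
  induction n generalizing k with
  | zero => exact MeasurableSet.const ((0 : ℕ∞) = k)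
  | succ n ih =>
    simp only [crossingTime_succ_eq_iff]
    refine measurableSet_setOfPred.2 (Measurable.exists fun j => ?_)
    refine Measurable.and measurable_const (Measurable.and (measurableSet_setOfPred.1 (ih j))
      (Measurable.and (measurableSet_setOfPred.1 (measurableSet_le measurable_const
        ((hs k).sub (hs j)))) (Measurable.forall fun i => ?_)))
    exact Measurable.imp measurable_const (Measurable.imp measurable_const
      (measurableSet_setOfPred.1 (measurableSet_lt ((hs i).sub (hs j)) measurable_const)))

theorem measurable_crossingTime {Ω : Type*} [MeasurableSpace Ω] {s : ℕ → Ω → ℝ}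
    (hs : ∀ i, Measurable (s i)) (c : ℝ) (n : ℕ) :
    Measurable fun ω => crossingTime (fun i => s i ω) c n :=
  ENat.measurable_iff.2 fun k => measurableSet_crossingTime_eq hs c n k

/-- In `ℕ` the supremum of an empty or unbounded set is `0`, so a positive value must be an attained
maximum. Hence no sign conditions on `c` and `t` are needed for measurability. -/
theorem nat_sSup_eq_succ_iff (S : Set ℕ) (k : ℕ) :
    sSup S = k + 1 ↔ k + 1 ∈ S ∧ ∀ n ∈ S, n ≤ k + 1 := by
  constructor
  · intro h
    have hne : S.Nonempty := by
      by_contra hne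
      rw [Set.not_nonempty_iff_eq_empty] at hne
      simp [hne] at h
    have hb : BddAbove S := by
      by_contra hb
      rw [Nat.sSup_of_not_bddAbove hb] at h
      omega
    exact ⟨h ▸ Nat.sSup_mem hne hb, fun n hn => h ▸ le_csSup hb hn⟩
  · rintro ⟨h1, h2⟩
    exact (show IsGreatest S (k + 1) from ⟨h1, h2⟩).csSup_eq

theorem measurable_crossingCount {Ω : Type*} [MeasurableSpace Ω] {s : ℕ → Ω → ℝ}
    (hs : ∀ i, Measurable (s i)) (c t : ℝ) :
    Measurable fun ω => crossingCount (fun i => s i ω) c t := by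
  have hmem : ∀ n : ℕ, Measurable fun ω =>
      ∃ k : ℕ, crossingTime (fun i => s i ω) c n = (k : ℕ∞) ∧ (k : ℝ) ≤ t := fun n =>
    Measurable.exists fun k => Measurable.and
      (measurableSet_setOfPred.1 (measurableSet_crossingTime_eq hs c n k)) measurable_const
  have hsucc : ∀ k : ℕ, MeasurableSet {ω | crossingCount (fun i => s i ω) c t = k + 1} := by
    intro k
    simp only [crossingCount, nat_sSup_eq_succ_iff, Set.mem_ofPred_eq]
    exact measurableSet_setOfPred.2 (Measurable.and (hmem _)
      (Measurable.forall fun n => Measurable.imp (hmem n) measurable_const))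
  refine measurable_to_countable' fun k => ?_
  cases k with
  | succ k => exact hsucc k
  | zero =>
    convert (MeasurableSet.iUnion hsucc).compl using 1
    ext ω
    simp only [Set.mem_preimage, Set.mem_singleton_iff, Set.mem_compl_iff, Set.mem_iUnion,
      Set.mem_ofPred_eq, not_exists]
    exact ⟨fun h k => by omega, fun h => by
      by_contra h0
      obtain ⟨k, hk⟩ := Nat.exists_eq_succ_of_ne_zero h0
      exact h k hk⟩

theorem measurable_lastCrossing {Ω : Type*} [MeasurableSpace Ω] {s : ℕ → Ω → ℝ}
    (hs : ∀ i, Measurable (s i)) (c t : ℝ) :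
    Measurable fun ω => lastCrossing (fun i => s i ω) c t := by
  -- The crossing index is itself random, so joint measurability in index and sample point is
  -- needed.
  have h : Measurable (Function.uncurry fun (n : ℕ) ω => crossingTime (fun i => s i ω) c n) :=
    measurable_from_prod_countable_right fun n => measurable_crossingTime hs c n
  exact (Measurable.of_discrete (f := ENat.toNat)).comp
    (h.comp ((measurable_crossingCount hs c t).prodMk measurable_id))

theorem measurable_crossingRate {Ω : Type*} [MeasurableSpace Ω] {s : ℕ → Ω → ℝ}
    (hs : ∀ i, Measurable (s i)) (c t : ℝ) :
    Measurable fun ω => crossingRate (fun i => s i ω) c t := by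
  have h1 : Measurable fun ω => (crossingCount (fun i => s i ω) c t : ℝ) :=
    (Measurable.of_discrete (f := fun n : ℕ => (n : ℝ))).comp (measurable_crossingCount hs c t)
  have h2 : Measurable fun ω => (lastCrossing (fun i => s i ω) c t : ℝ) :=
    (Measurable.of_discrete (f := fun n : ℕ => (n : ℝ))).comp (measurable_lastCrossing hs c t)
  exact (h1.const_mul c).div h2

theorem measurable_partialSum {Ω : Type*} [MeasurableSpace Ω] {X : ℕ → Ω → ℝ}
    (hX : ∀ i, Measurable (X i)) (n : ℕ) : Measurable fun ω => partialSum (fun i => X i ω) n :=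
  Finset.measurable_fun_sum _ fun i _ => hX i

/-! ### Almost sure convergence by the strong law. -/

theorem tendsto_integral_truncation {Ω : Type*} [MeasurableSpace Ω] {P : Measure Ω} {Y : Ω → ℝ}
    (hY : Integrable Y P) :
    Tendsto (fun A : ℕ => ∫ ω, max (Y ω - A) 0 ∂P) atTop (𝓝 0) := by
  have h := tendsto_integral_of_dominated_convergence (μ := P)
    (F := fun (A : ℕ) ω => max (Y ω - A) 0) (f := fun _ => 0) (fun ω => |Y ω|)
    (fun A => ((hY.aestronglyMeasurable.sub aestronglyMeasurable_const).sup
      aestronglyMeasurable_const)) hY.abs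
    (fun A => ae_of_all _ fun ω => by
      rw [Real.norm_eq_abs, abs_of_nonneg (le_max_right _ _)]
      exact max_le (by linarith [le_abs_self (Y ω), Nat.cast_nonneg (α := ℝ) A]) (abs_nonneg _))
    (ae_of_all _ fun ω => by
      refine tendsto_const_nhds.congr' ?_
      filter_upwards [eventually_ge_atTop ⌈Y ω⌉₊] with A hA
      rw [max_eq_right]
      linarith [Nat.ceil_le.1 hA])
  simpa using h

/-- Along almost every path of an i.i.d. sequence with positive mean, the crossing rate converges
to the mean. -/
theorem ae_tendsto_crossingRate {Ω : Type*} [MeasurableSpace Ω] {P : Measure Ω}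
    {Y : ℕ → Ω → ℝ} (hint : Integrable (Y 0) P) (hindep : iIndepFun Y P)
    (hident : ∀ i, IdentDistrib (Y i) (Y 0) P P) (hmean : 0 < ∫ ω, Y 0 ω ∂P)
    {ι : Type*} {l : Filter ι} {c t : ι → ℝ}
    (hc : Tendsto c l atTop) (ht : Tendsto t l atTop)
    (hct : Tendsto (fun j => c j / t j) l (𝓝 0)) :
    ∀ᵐ ω ∂P, Tendsto (fun j => crossingRate (partialSum fun i => Y i ω) (c j) (t j)) l
      (𝓝 (∫ ω, Y 0 ω ∂P)) := by
  have : IsProbabilityMeasure P := hindep.isProbabilityMeasure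
  have h1 := strong_law_ae_real Y hint (fun i j hij => hindep.indepFun hij) hident
  -- Natural truncation levels suffice, and being countable they share one null set.
  have h2 : ∀ᵐ ω ∂P, ∀ A : ℕ, Tendsto (fun n : ℕ =>
      partialSum (fun i => max (Y i ω - A) 0) n / n) atTop
        (𝓝 (∫ ω, max (Y 0 ω - A) 0 ∂P)) := by
    refine ae_all_iff.2 fun A => ?_
    have hg : Measurable fun y : ℝ => max (y - A) 0 := by fun_prop
    exact strong_law_ae_real (fun i ω => max (Y i ω - A) 0)
      ((hint.sub (integrable_const _)).sup (integrable_const _))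
      (fun i j hij => (hindep.indepFun hij).comp hg hg) (fun i => (hident i).comp hg)
  filter_upwards [h1, h2] with ω hω1 hω2
  refine tendsto_crossingRate hmean hω1 (fun ε hε => ?_) hc ht hct
  obtain ⟨A, hA⟩ := ((tendsto_integral_truncation hint).eventually_lt_const hε).exists
  exact ⟨A, (hω2 A).eventually_lt_const hA⟩

end HittingSampling


namespace HittingSampling

/-! ### From almost sure convergence to convergence in probability. -/

/-- Sampling rates that tend to infinity with `Δ, Γ = o(t)` do so along a countably generated
filter coarser than the given one. -/
theorem exists_isCountablyGenerated_ge {ι : Type*} {l : Filter ι} {Δ Γ t : ι → ℝ}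
    (hΔ : Tendsto Δ l atTop) (hΓ : Tendsto Γ l atTop) (ht : Tendsto t l atTop)
    (hΔt : Tendsto (fun j => Δ j / t j) l (𝓝 0)) (hΓt : Tendsto (fun j => Γ j / t j) l (𝓝 0)) :
    ∃ l' : Filter ι, l'.IsCountablyGenerated ∧ l ≤ l' ∧ Tendsto Δ l' atTop ∧ Tendsto Γ l' atTop ∧
      Tendsto t l' atTop ∧ Tendsto (fun j => Δ j / t j) l' (𝓝 0) ∧
      Tendsto (fun j => Γ j / t j) l' (𝓝 0) := by
  refine ⟨comap Δ atTop ⊓ (comap Γ atTop ⊓ (comap t atTop ⊓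
    (comap (fun j => Δ j / t j) (𝓝 0) ⊓ comap (fun j => Γ j / t j) (𝓝 0)))), inferInstance,
    ?_, tendsto_comap.mono_left inf_le_left,
    tendsto_comap.mono_left (inf_le_right.trans inf_le_left),
    tendsto_comap.mono_left (inf_le_right.trans (inf_le_right.trans inf_le_left)),
    tendsto_comap.mono_left
      (inf_le_right.trans (inf_le_right.trans (inf_le_right.trans inf_le_left))),
    tendsto_comap.mono_left
      (inf_le_right.trans (inf_le_right.trans (inf_le_right.trans inf_le_right)))⟩
  simp only [le_inf_iff, ← tendsto_iff_comap]
  exact ⟨hΔ, hΓ, ht, hΔt, hΓt⟩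

theorem measurable_sigmaHat {Ω : Type*} [MeasurableSpace Ω] {X : ℕ → Ω → ℝ}
    (hX : ∀ i, Measurable (X i)) (Δ Γ t : ℝ) :
    Measurable fun ω => sigmaHat (fun i => X i ω) Δ Γ t :=
  ((measurable_crossingRate (measurable_partialSum fun i => (hX i).pow_const 2) Γ t).sub
    ((measurable_crossingRate (measurable_partialSum hX) Δ t).pow_const 2)).sqrt

end HittingSampling

theorem mainTheorem9 {Ω : Type*} [MeasurableSpace Ω] (P : MeasureTheory.Measure Ω)
    [MeasureTheory.IsProbabilityMeasure P] (X : ℕ → Ω → ℝ)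
    (hmeas : ∀ i, Measurable (X i))
    (hindep : ProbabilityTheory.iIndepFun X P)
    (hident : ∀ i, ProbabilityTheory.IdentDistrib (X i) (X 0) P P)
    (hmean : 0 < ∫ ω, X 0 ω ∂P)
    (hthird : MeasureTheory.Integrable (fun ω => |X 0 ω| ^ 3) P)
    {ι : Type*} (l : Filter ι) (Δ Γ t : ι → ℝ)
    (hΔ : Filter.Tendsto Δ l Filter.atTop)
    (hΓ : Filter.Tendsto Γ l Filter.atTop)
    (ht : Filter.Tendsto t l Filter.atTop)
    (hΔt : Asymptotics.IsLittleO l Δ t)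
    (hΓt : Asymptotics.IsLittleO l Γ t) :
    Filter.Tendsto
      (fun j => P {ω |
        1 ≤ HittingSampling.crossingCount
          (HittingSampling.partialSum fun i => X i ω) (Δ j) (t j) ∧
        1 ≤ HittingSampling.crossingCount
          (HittingSampling.partialSum fun i => X i ω ^ 2) (Γ j) (t j)})
      l (nhds 1) ∧
    MeasureTheory.TendstoInMeasure P
      (fun j ω => HittingSampling.sigmaHat (fun i => X i ω) (Δ j) (Γ j) (t j))
      l (fun _ => √(ProbabilityTheory.variance (X 0) P)) := by
  -- Passing from almost sure convergence to probabilities uses dominated convergence, which needs a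
  -- countably generated filter; limits along `l'` restrict to `l ≤ l'`.
  obtain ⟨l', hl', hle, hΔ, hΓ, ht, hΔt, hΓt⟩ := HittingSampling.exists_isCountablyGenerated_ge
    hΔ hΓ ht hΔt.tendsto_div_nhds_zero hΓt.tendsto_div_nhds_zero
  have hL2 : MemLp (X 0) 2 P := by
    have h3 : MemLp (X 0) 3 P := by
      rw [← integrable_norm_rpow_iff (hmeas 0).aestronglyMeasurable (by norm_num) (by norm_num)]
      simpa only [ENNReal.toReal_ofNat, Real.rpow_ofNat, Real.norm_eq_abs] using hthird
    exact h3.mono_exponent (by norm_num)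
  have hvar := variance_eq_sub hL2
  -- Nonnegative variance gives a second moment of at least the squared mean.
  have hsq : 0 < ∫ ω, X 0 ω ^ 2 ∂P := by
    have h0 := variance_nonneg (X 0) P
    simp only [Pi.pow_apply] at hvar
    nlinarith [pow_pos hmean 2]
  have hμ := HittingSampling.ae_tendsto_crossingRate (hL2.integrable one_le_two) hindep hident
    hmean hΔ ht hΔt
  have hsqm : Measurable fun y : ℝ => y ^ 2 := measurable_id.pow_const 2
  have hM := HittingSampling.ae_tendsto_crossingRate (Y := fun i ω => X i ω ^ 2) hL2.integrable_sq
    (hindep.comp (fun _ y => y ^ 2) fun _ => hsqm) (fun i => (hident i).comp hsqm) hsq hΓ ht hΓt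
  constructor
  · refine Tendsto.mono_left ?_ hle
    have h := tendsto_measure_of_ae_tendsto_indicator_of_isFiniteMeasure (μ := P)
      (As := fun j => {ω |
        1 ≤ HittingSampling.crossingCount
          (HittingSampling.partialSum fun i => X i ω) (Δ j) (t j) ∧
        1 ≤ HittingSampling.crossingCount
          (HittingSampling.partialSum fun i => X i ω ^ 2) (Γ j) (t j)})
      l' MeasurableSet.univ (fun j => ?_) ?_
    · rwa [measure_univ] at h
    · exact (measurableSet_le measurable_const (HittingSampling.measurable_crossingCount
        (HittingSampling.measurable_partialSum hmeas) _ _)).inter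
        (measurableSet_le measurable_const (HittingSampling.measurable_crossingCount
        (HittingSampling.measurable_partialSum fun i => (hmeas i).pow_const 2) _ _))
    · filter_upwards [hμ, hM] with ω h1 h2
      filter_upwards [HittingSampling.eventually_one_le_crossingCount hmean h1,
        HittingSampling.eventually_one_le_crossingCount hsq h2] with j hj1 hj2
      exact ⟨fun _ => trivial, fun _ => ⟨hj1, hj2⟩⟩
  · intro ε hε
    refine Tendsto.mono_left ?_ hle
    -- On almost every path the deviation event eventually fails, so its indicator tends to that of
    -- `∅`.
    have h := tendsto_measure_of_ae_tendsto_indicator_of_isFiniteMeasure (μ := P)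
      (As := fun j => {ω | ε ≤ edist (HittingSampling.sigmaHat (fun i => X i ω) (Δ j) (Γ j) (t j))
        √(ProbabilityTheory.variance (X 0) P)})
      l' MeasurableSet.empty (fun j => ?_) ?_
    · rwa [measure_empty] at h
    · exact measurableSet_le measurable_const
        ((HittingSampling.measurable_sigmaHat hmeas _ _ _).edist measurable_const)
    · filter_upwards [hμ, hM] with ω h1 h2
      have h3 : Tendsto (fun j => HittingSampling.sigmaHat (fun i => X i ω) (Δ j) (Γ j) (t j)) l'
          (𝓝 √(ProbabilityTheory.variance (X 0) P)) := by
        rw [hvar]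
        exact (h2.sub (h1.pow 2)).sqrt
      filter_upwards [(tendsto_iff_edist_tendsto_0.1 h3).eventually_lt_const hε] with j hj
      exact ⟨fun h => absurd h hj.not_ge, fun h => h.elim⟩
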